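/- Let $G \ge 2$, $K \ge 1$ and $N \ge 1$ be integers. A dispute among $N$ claims proceeds in rounds. Every claim carries a demotion count, which is initially $0$; a claim is eliminated as soon as its demotion count reaches $K$. In each round the surviving claims are sorted by increasing demotion count (ties broken arbitrarily) and consumed in this order to form groups of $G$ claims each, where the last group may have fewer than $G$ claims. In every group exactly one claim wins and keeps its demotion count (a claim alone in its group wins it), and the demotion count of every other claim in the group increases by $1$. The dispute is settled when exactly one claim survives. Then, whatever claims an adversary selects as winners of the groups in every round, the dispute is settled after some number $R$ of rounds with $$R < 13K + \log_G N + 2\sqrt{K\log_G N}.$$ In particular, the dispute is settled within $O\big(K + \log_G N + \sqrt{K \log_G N}\,\big)$ rounds, with an absolute implied constant. -/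

import Mathlib

/-- The claims still in the dispute when claim `a` has been demoted `d a` times:
a claim is eliminated when its demotion count reaches `K`. -/
def surviving {ι : Type*} [Fintype ι] (K : ℕ) (d : ι → ℕ) : Finset ι :=
  Finset.univ.filter fun a => d a < K

/-- `pos` lists the surviving claims (as positions `0, 1, …, m - 1`, where `m` is the number of
survivors) in order of increasing demotion count. Ties may be broken in any way. -/
structure IsSorting {ι : Type*} [Fintype ι] (K : ℕ) (d : ι → ℕ) (pos : ι → ℕ) : Prop where
  bijOn : Set.BijOn pos (surviving K d : Set ι) (Set.Iio (surviving K d).card)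
  sorted : ∀ a ∈ surviving K d, ∀ b ∈ surviving K d, d a < d b → pos a < pos b

/-- One round of the dispute can turn the demotion counts `d` into `d'`.

The surviving claims are sorted by increasing demotion count and consumed in order, forming groups
of `G` claims each (the last group may be smaller): the claim at position `i` is in group `i / G`.
Each group has exactly one winner (`W` is the set of winners; a claim alone in its group wins it),
chosen arbitrarily. Every other surviving claim gets one more demotion. -/
def IsRound {ι : Type*} [Fintype ι] (G K : ℕ) (d d' : ι → ℕ) : Prop :=
  ∃ pos : ι → ℕ, IsSorting K d pos ∧
    ∃ W : Finset ι, W ⊆ surviving K d ∧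
      (∀ a ∈ surviving K d, ∃! w, w ∈ W ∧ pos w / G = pos a / G) ∧
      (∀ a ∈ surviving K d, a ∉ W → d' a = d a + 1) ∧
      (∀ a, a ∈ W ∨ a ∉ surviving K d → d' a = d a)

/-- A possible history of a dispute, with group size `G` and elimination after `K` demotions:
`d j a` is the demotion count of claim `a` after `j` rounds. All claims start undemoted, and all
choices in every round are arbitrary (they may depend on everything). Once a single claim is
left, further rounds change nothing. -/
structure IsDispute {ι : Type*} [Fintype ι] (G K : ℕ) (d : ℕ → ι → ℕ) : Prop where
  start : ∀ a, d 0 a = 0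
  round : ∀ j, IsRound G K (d j) (d (j + 1))

/-! Let `B i` be the sum of the truncated differences `i - d a`. Losing cancels a shift of `i` by
one, so after a round the new `B (i+1)` is the old `B i` plus the number of winners with at most `i`
demotions. Sorting packs the `S = B (i+1) - B i` such claims into the first `⌈S/G⌉` groups, which
bounds these winners (`exists_winners_of_isRound`). Hence the excess `B i - i` obeys a linear
recursion dominated by `(N-1) z^i q^t`. Once this is below 1 at `i = K`, the budget is at most `K`,
and every further unsettled round lowers it. -/

/-- The total number of demotions that the claims can still take before each of them has been
demoted `i` times. -/
def demotionBudget {ι : Type*} [Fintype ι] (d : ι → ℕ) (i : ℕ) : ℕ := ∑ a, (i - d a)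

section Round

variable {ι : Type*} [Fintype ι]

theorem demotionBudget_zero (d : ι → ℕ) : demotionBudget d 0 = 0 := by
  simp [demotionBudget]

theorem demotionBudget_succ (d : ι → ℕ) (i : ℕ) :
    demotionBudget d (i + 1) = demotionBudget d i + (surviving (i + 1) d).card := by
  rw [surviving, Finset.card_filter, demotionBudget, demotionBudget, ← Finset.sum_add_distrib]
  refine Finset.sum_congr rfl fun a _ => ?_
  split_ifs <;> omega

theorem IsSorting.pos_lt_card {K : ℕ} {d pos : ι → ℕ} (h : IsSorting K d pos) {i : ℕ}
    (hi : i ≤ K) {w : ι} (hw : d w < i) : pos w < (surviving i d).card := by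
  classical
  have hwK : w ∈ surviving K d := by simp [surviving]; omega
  have hsub : Finset.range (pos w + 1) ⊆ (surviving i d).image pos := by
    intro p hp
    have hpw : p ≤ pos w := by simpa [Nat.lt_succ_iff] using hp
    obtain ⟨b, hb, rfl⟩ := h.bijOn.surjOn
      (show p ∈ Set.Iio (surviving K d).card from
        lt_of_le_of_lt hpw (h.bijOn.mapsTo hwK))
    refine Finset.mem_image_of_mem pos ?_
    by_contra hbi
    have hdb : i ≤ d b := by simpa [surviving] using hbi
    have := h.sorted w hwK b hb (by omega)
    omega
  have := (Finset.card_le_card hsub).trans Finset.card_image_le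
  simpa using this

theorem exists_winners_of_isRound {G K : ℕ} (hG : 0 < G) {d d' : ι → ℕ} (h : IsRound G K d d')
    {i : ℕ} (hi : i + 1 ≤ K) :
    ∃ w : ℕ, demotionBudget d' (i + 1) = demotionBudget d i + w ∧
      G * w ≤ (surviving (i + 1) d).card + (G - 1) := by
  classical
  obtain ⟨pos, hpos, W, hW, huniq, hlose, hkeep⟩ := h
  -- Truncation is harmless for eliminated claims: they contribute 0 on both sides because `i + 1 ≤
  -- K`.
  refine ⟨(W.filter fun a => d a < i + 1).card, ?_, ?_⟩
  · rw [← Finset.filter_univ_mem W, Finset.filter_filter, Finset.card_filter, demotionBudget,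
      demotionBudget, ← Finset.sum_add_distrib]
    refine Finset.sum_congr rfl fun a _ => ?_
    by_cases haW : a ∈ W
    · rw [hkeep a (Or.inl haW)]
      simp only [haW, true_and]
      split_ifs <;> omega
    · simp only [haW, false_and, if_false]
      by_cases haS : a ∈ surviving K d
      · rw [hlose a haS haW]; omega
      · rw [hkeep a (Or.inr haS)]
        have : K ≤ d a := by simpa [surviving] using haS
        omega
  · set S := (surviving (i + 1) d).card with hS
    have hinj : Set.InjOn (fun a => pos a / G) (W.filter fun a => d a < i + 1 : Finset ι) := by
      intro a ha b hb hab
      have ha' := (Finset.mem_filter.1 ha).1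
      have hb' := (Finset.mem_filter.1 hb).1
      exact (huniq b (hW hb')).unique ⟨ha', hab⟩ ⟨hb', rfl⟩
    have hmaps : ∀ a ∈ W.filter (fun a => d a < i + 1),
        pos a / G ∈ Finset.range ((S + (G - 1)) / G) := by
      intro a ha
      have hlt := hpos.pos_lt_card hi (Finset.mem_filter.1 ha).2
      rw [Finset.mem_range, Nat.lt_iff_add_one_le, Nat.le_div_iff_mul_le hG, add_mul]
      have := Nat.div_mul_le_self (pos a) G
      omega
    have hcard := Finset.card_le_card_of_injOn _ hmaps hinj
    rw [Finset.card_range, Nat.le_div_iff_mul_le hG] at hcard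
    linarith

theorem IsRound.surviving_nonempty {G K : ℕ} {d d' : ι → ℕ} (h : IsRound G K d d')
    (hd : (surviving K d).Nonempty) : (surviving K d').Nonempty := by
  obtain ⟨pos, hpos, W, hW, huniq, hlose, hkeep⟩ := h
  obtain ⟨a, ha⟩ := hd
  obtain ⟨w, ⟨hw, -⟩, -⟩ := huniq a ha
  refine ⟨w, ?_⟩
  have := hW hw
  simp only [surviving, Finset.mem_filter, Finset.mem_univ, true_and] at this ⊢
  rwa [hkeep w (Or.inl hw)]

theorem IsRound.demotionBudget_lt {G K : ℕ} (hG : 2 ≤ G) {d d' : ι → ℕ} (h : IsRound G K d d')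
    (hd : 2 ≤ (surviving K d).card) : demotionBudget d' K < demotionBudget d K := by
  obtain _ | i := K
  · simp [surviving] at hd
  obtain ⟨w, hw, hle⟩ := exists_winners_of_isRound (by omega) h le_rfl
  rw [hw, demotionBudget_succ]
  by_contra! hcon
  obtain ⟨g, rfl⟩ := Nat.exists_eq_add_of_le hG
  have hgw : (2 + g) * (surviving (i + 1) d).card ≤ (2 + g) * w :=
    Nat.mul_le_mul_left _ (by omega)
  have : g * 2 ≤ g * (surviving (i + 1) d).card := Nat.mul_le_mul_left _ hd
  rw [add_mul] at hgw
  omega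

/-- The excess of the demotion budget over that of a single undemoted claim contracts like an
averaging process. -/
theorem IsRound.excess_le {G K : ℕ} (hG : 0 < G) {d d' : ι → ℕ} (h : IsRound G K d d')
    {i : ℕ} (hi : i + 1 ≤ K) :
    (G : ℝ) * (demotionBudget d' (i + 1) - ((i + 1 : ℕ) : ℝ)) ≤
      (G - 1) * (demotionBudget d i - (i : ℝ)) +
        (demotionBudget d (i + 1) - ((i + 1 : ℕ) : ℝ)) := by
  obtain ⟨w, hw, hle⟩ := exists_winners_of_isRound hG h hi
  rw [hw, demotionBudget_succ]
  have hle' : (G : ℝ) * w ≤ (surviving (i + 1) d).card + (G - 1) := by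
    have : ((G * w : ℕ) : ℝ) ≤ (((surviving (i + 1) d).card + (G - 1) : ℕ) : ℝ) := by
      exact_mod_cast hle
    push_cast [Nat.cast_sub (Nat.one_le_iff_ne_zero.2 hG.ne')] at this
    exact this
  push_cast
  linarith

end Round

/-- The relation `hq` makes `z^i q^t` an exact solution of the recursion; `2 ≤ z` gives `i ≤ z^i` at
the start. -/
theorem IsDispute.excess_le_geometric {G K N : ℕ} (hG : 0 < G) (hN : 1 ≤ N)
    {d : ℕ → Fin N → ℕ} (hd : IsDispute G K d) {z q : ℝ} (hz : 2 ≤ z)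
    (hq : (G : ℝ) * (q * z) = (G - 1) + z) (hq0 : 0 ≤ q) (t : ℕ) :
    ∀ i ≤ K, (demotionBudget (d t) i : ℝ) - i ≤ (N - 1) * (z ^ i * q ^ t) := by
  have hN' : (0 : ℝ) ≤ N - 1 := by
    have : (1 : ℝ) ≤ N := by exact_mod_cast hN
    linarith
  have hG1 : (0 : ℝ) ≤ (G : ℝ) - 1 := by
    have : (1 : ℝ) ≤ G := by exact_mod_cast hG
    linarith
  induction t with
  | zero =>
    intro i _
    have h1 : (i : ℝ) ≤ z ^ i :=
      calc (i : ℝ) ≤ 2 ^ i := by exact_mod_cast Nat.lt_two_pow_self.le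
        _ ≤ z ^ i := by gcongr
    have h2 : (demotionBudget (d 0) i : ℝ) = N * i := by simp [demotionBudget, hd.start]
    rw [h2, pow_zero, mul_one]
    nlinarith [mul_le_mul_of_nonneg_left h1 hN']
  | succ t ih =>
    intro i hi
    obtain _ | i := i
    · simp only [demotionBudget_zero, Nat.cast_zero, sub_zero, pow_zero, one_mul]
      positivity
    have hstep := (hd.round t).excess_le hG hi
    have h1 := mul_le_mul_of_nonneg_left (ih i (by omega)) hG1
    have h2 := ih (i + 1) hi
    have hG0 : (0 : ℝ) < G := by exact_mod_cast hG
    refine le_of_mul_le_mul_left ?_ hG0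
    calc (G : ℝ) * (demotionBudget (d (t + 1)) (i + 1) - ((i + 1 : ℕ) : ℝ))
        ≤ (G - 1) * ((N - 1) * (z ^ i * q ^ t)) + (N - 1) * (z ^ (i + 1) * q ^ t) := by
          linarith
      _ = (N - 1) * z ^ i * q ^ t * ((G - 1) + z) := by ring
      _ = G * ((N - 1) * (z ^ (i + 1) * q ^ (t + 1))) := by rw [← hq]; ring

theorem IsDispute.surviving_nonempty {G K N : ℕ} (hK : 1 ≤ K) (hN : 1 ≤ N)
    {d : ℕ → Fin N → ℕ} (hd : IsDispute G K d) (t : ℕ) : (surviving K (d t)).Nonempty := by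
  induction t with
  | zero => exact ⟨⟨0, hN⟩, Finset.mem_filter.2 ⟨Finset.mem_univ _, by rwa [hd.start]⟩⟩
  | succ t ih => exact (hd.round t).surviving_nonempty ih

theorem IsDispute.exists_settled_of_demotionBudget_le {G K N : ℕ} (hG : 2 ≤ G) (hK : 1 ≤ K)
    (hN : 1 ≤ N) {d : ℕ → Fin N → ℕ} (hd : IsDispute G K d) {t m : ℕ}
    (h : demotionBudget (d t) K ≤ m + 1) :
    ∃ r ≤ t + m, (surviving K (d r)).card = 1 := by
  by_contra! hcon
  have htwo : ∀ r ≤ t + m, 2 ≤ (surviving K (d r)).card := fun r hr => by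
    have := hcon r hr
    have := (hd.surviving_nonempty hK hN r).card_pos
    omega
  have hdec : ∀ j ≤ m, demotionBudget (d (t + j)) K + j ≤ m + 1 := by
    intro j
    induction j with
    | zero => simpa using h
    | succ j ih =>
      intro hj
      have := ih (by omega)
      have := (hd.round (t + j)).demotionBudget_lt hG (htwo _ (by omega))
      change demotionBudget (d (t + j + 1)) K + (j + 1) ≤ m + 1
      omega
  have h1 := hdec m le_rfl
  have h2 := htwo (t + m) le_rfl
  -- Two survivors force a budget of at least 2, but `h1` leaves at most 1.
  obtain ⟨k, rfl⟩ := Nat.exists_eq_add_of_le' hK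
  rw [demotionBudget_succ] at h1
  omega

/-- This is the logarithm of `N z^K q^t ≤ 1` per unit of `K`, with `g = log G`, `log N = K s² g` and
`log (G - 1)` replaced by `g`. -/
theorem exponent_inequality {g s : ℝ} (hg : Real.log 2 ≤ g) (hs : 0 ≤ s) :
    (s ^ 2 + 1) * g + Real.log (4 + 2 * s) ≤
      (12 + 2 * s + s ^ 2) * (g - Real.log (1 + 1 / (4 + 2 * s))) := by
  have hl2 := Real.log_two_gt_d9
  have h1 : Real.log (4 + 2 * s) ≤ 2 * g + s / 2 := by
    have : (4 : ℝ) + 2 * s = 2 ^ 2 * (1 + s / 2) := by ring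
    rw [this, Real.log_mul (by norm_num) (by positivity), Real.log_pow]
    have := Real.log_le_sub_one_of_pos (show 0 < 1 + s / 2 by positivity)
    push_cast
    linarith
  have h2 : (12 + 2 * s + s ^ 2) * Real.log (1 + 1 / (4 + 2 * s)) ≤ 3 + s / 2 := by
    have h3 := Real.log_le_sub_one_of_pos (show 0 < 1 + 1 / (4 + 2 * s) by positivity)
    calc (12 + 2 * s + s ^ 2) * Real.log (1 + 1 / (4 + 2 * s))
        ≤ (12 + 2 * s + s ^ 2) * (1 / (4 + 2 * s)) := by gcongr; linarith
      _ ≤ 3 + s / 2 := by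
        rw [mul_one_div, div_le_iff₀ (by positivity)]
        nlinarith
  nlinarith [mul_nonneg hs (sub_nonneg.2 hg)]

theorem mul_pow_mul_pow_le_one {G K N : ℕ} (hG : 2 ≤ G) (hN : 1 ≤ N) {s : ℝ}
    (hs : 0 ≤ s) (hL : Real.logb G N = K * s ^ 2) {t : ℕ}
    (ht : (K : ℝ) * (12 + 2 * s + s ^ 2) ≤ t) :
    (N : ℝ) * ((((G : ℝ) - 1) * (4 + 2 * s)) ^ K * ((1 + 1 / (4 + 2 * s)) / G) ^ t) ≤ 1 := by
  have hG' : (2 : ℝ) ≤ G := by exact_mod_cast hG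
  have hN' : (0 : ℝ) < N := by exact_mod_cast hN
  have hg : Real.log 2 ≤ Real.log G := Real.log_le_log (by norm_num) hG'
  have hg0 : 0 < Real.log G := Real.log_pos (by linarith)
  have hG1 : (0 : ℝ) < (G : ℝ) - 1 := by linarith
  have hlogN : Real.log N = K * s ^ 2 * Real.log G := by
    rw [← hL, Real.logb, div_mul_cancel₀ _ hg0.ne']
  have hineq := exponent_inequality hg hs
  have hlc : 0 ≤ Real.log (4 + 2 * s) := Real.log_nonneg (by linarith)
  -- The decay rate `-log q` is nonnegative, so a larger `t` only helps.
  have hpos : 0 ≤ Real.log G - Real.log (1 + 1 / (4 + 2 * s)) := by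
    have h1 : 0 ≤ (s ^ 2 + 1) * Real.log G + Real.log (4 + 2 * s) := by positivity
    exact nonneg_of_mul_nonneg_right (h1.trans hineq) (by positivity)
  have hlogG : Real.log ((G : ℝ) - 1) ≤ Real.log G := Real.log_le_log hG1 (by linarith)
  rw [← Real.log_nonpos_iff (by positivity), Real.log_mul (by positivity) (by positivity),
    Real.log_mul (by positivity) (by positivity), Real.log_pow, Real.log_pow,
    Real.log_mul (by positivity) (by positivity), Real.log_div (by positivity) (by positivity),
    hlogN]
  have h1 := mul_le_mul_of_nonneg_right ht hpos
  have h2 := mul_le_mul_of_nonneg_left hineq (Nat.cast_nonneg (α := ℝ) K)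
  have h3 := mul_le_mul_of_nonneg_left hlogG (Nat.cast_nonneg (α := ℝ) K)
  nlinarith

theorem theorem1 (G K N : ℕ) (hG : 2 ≤ G) (hK : 1 ≤ K) (hN : 1 ≤ N)
    (d : ℕ → Fin N → ℕ) (hd : IsDispute G K d) :
    ∃ r : ℕ, (surviving K (d r)).card = 1 ∧
      (r : ℝ) < 13 * (K : ℝ) + Real.logb (G : ℝ) (N : ℝ)
        + 2 * Real.sqrt ((K : ℝ) * Real.logb (G : ℝ) (N : ℝ)) := by
  have hG' : (2 : ℝ) ≤ G := by exact_mod_cast hG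
  have hN' : (1 : ℝ) ≤ N := by exact_mod_cast hN
  have hK' : (0 : ℝ) < K := by exact_mod_cast hK
  set L := Real.logb (G : ℝ) (N : ℝ) with hLdef
  have hL0 : 0 ≤ L := Real.logb_nonneg (by linarith) hN'
  set s := Real.sqrt (L / K)
  have hs : 0 ≤ s := Real.sqrt_nonneg _
  have hLs : L = K * s ^ 2 := by
    rw [Real.sq_sqrt (by positivity), mul_div_cancel₀ _ hK'.ne']
  have hsqrt : Real.sqrt (K * L) = K * s := by
    rw [hLs, show (K : ℝ) * (K * s ^ 2) = (K * s) ^ 2 by ring, Real.sqrt_sq (by positivity)]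
  set t := ⌈(K : ℝ) * (12 + 2 * s + s ^ 2)⌉₊
  have ht : (K : ℝ) * (12 + 2 * s + s ^ 2) ≤ t := Nat.le_ceil _
  have ht' : (t : ℝ) < K * (12 + 2 * s + s ^ 2) + 1 := Nat.ceil_lt_add_one (by positivity)
  set z := ((G : ℝ) - 1) * (4 + 2 * s) with hz
  set q := (1 + 1 / (4 + 2 * s)) / (G : ℝ) with hq
  have hG1 : (0 : ℝ) < (G : ℝ) - 1 := by linarith
  have hsmall := mul_pow_mul_pow_le_one hG hN hs (hLdef.symm.trans hLs) ht
  have hgeom := hd.excess_le_geometric (by omega) hN (z := z) (q := q) (by nlinarith)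
    (by rw [hz, hq]; field_simp; ring) (by positivity) t K le_rfl
  have hzq : 0 < z ^ K * q ^ t := by positivity
  have hbudget : demotionBudget (d t) K ≤ (K - 1) + 1 := by
    -- Strict because the factor is `N - 1` while `hsmall` has `N`.
    have : (demotionBudget (d t) K : ℝ) < (K + 1 : ℕ) := by
      push_cast
      linarith
    have : demotionBudget (d t) K < K + 1 := by exact_mod_cast this
    omega
  obtain ⟨r, hr, hcard⟩ := hd.exists_settled_of_demotionBudget_le hG hK hN hbudget
  refine ⟨r, hcard, ?_⟩
  -- The last `K - 1` rounds and the rounding up in `t` together cost less than `K`, turning `12K`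
  -- into `13K`.
  have hr' : (r : ℝ) + 1 ≤ t + K := by
    have : r + 1 ≤ t + K := by omega
    exact_mod_cast this
  rw [hsqrt]
  linarith
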